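/- Let $G$ be the following incremental algorithm for the Delaunay triangulation of a sequence of points of $\mathbb{R}^2$. The unbounded region is triangulated by joining each hull vertex to a symbolic vertex $\infty$; the circumdisk of an unbounded triangle is the open half-plane bounded by the line of its hull edge and not containing the point set (so two points $a,b$ give the two unbounded triangles $ab\infty$, $ba\infty$). The first two points cost nothing. Each further point $p$ is inserted in two steps. (1) Location: $G$ walks along the straight segment from the last inserted point to $p$ until it reaches a triangle containing $p$; each edge crossed is one navigation operation (a last inserted point on the hull that has a hull edge visible from $p$ needs none). (2) Update: $G$ joins $p$ to the three vertices of that triangle and, as long as some edge opposite to $p$ is invalid, i.e. $p$ lies strictly inside the circumdisk of the triangle on its other side, flips it; each flip is one flip operation. For an integer $k>0$, a sequence $\langle p_1,\dots,p_m\rangle$ is amortized $k$-D-linear if for every $i\le m$ the algorithm $G$ performs in total at most $k\,i$ navigation and flip operations on $\langle p_1,\dots,p_i\rangle$. An amortized $k$-D-linear run of a sequence $S$ is a nonempty subsequence of consecutive points of $S$ that is amortized $k$-D-linear. Amortized greedy partitioning reads $S$ from left to right; it adds the next point $p$ to the current run if $G$, run on the current run, inserts $p$ with $r\le k+c$ operations,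 where $c$ is the current credit, and then the credit becomes $k+c-r$; otherwise it closes the current run and restarts $G$ with a new run that begins with $p$ (a new run starts with credit $0$ before its first point). An optimal partition of $S$ is a partition into the minimum number of amortized $k$-D-linear runs. Claim: for every integer $k>0$ there is a family $(S_n)_{n\ge 0}$, where $S_n$ is a sequence of $n$ distinct points of $\mathbb{R}^2$, no three of them collinear, such that amortized greedy partitioning with threshold $k$ cuts $S_n$ into $\Theta(n)$ amortized $k$-D-linear runs as $n\to\infty$ (the constants may depend on $k$), while for all sufficiently large $n$ the optimal partition of $S_n$ has exactly $2$ amortized $k$-D-linear runs. -/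

import Mathlib

open Filter Asymptotics

namespace DelaunayRuns

/-! ## Geometric tests -/

/-- Points of the Euclidean plane, in coordinates. -/
abbrev Point : Type := ℝ × ℝ

/-- Orientation test: positive iff `c` lies strictly to the left of the directed line `a → b`. -/
def orient (a b c : Point) : ℝ :=
  (b.1 - a.1) * (c.2 - a.2) - (b.2 - a.2) * (c.1 - a.1)

/-- Incircle test: for a counterclockwise triangle `a b c`, positive iff `d` lies strictly inside
its circumcircle. -/
def inCircle (a b c d : Point) : ℝ :=
  (a.1 - d.1) * ((b.2 - d.2) * ((c.1 - d.1) ^ 2 + (c.2 - d.2) ^ 2)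
      - (c.2 - d.2) * ((b.1 - d.1) ^ 2 + (b.2 - d.2) ^ 2))
    - (a.2 - d.2) * ((b.1 - d.1) * ((c.1 - d.1) ^ 2 + (c.2 - d.2) ^ 2)
      - (c.1 - d.1) * ((b.1 - d.1) ^ 2 + (b.2 - d.2) ^ 2))
    + ((a.1 - d.1) ^ 2 + (a.2 - d.2) ^ 2)
      * ((b.1 - d.1) * (c.2 - d.2) - (c.1 - d.1) * (b.2 - d.2))

/-! ## Triangulations

As usual, the unbounded region is cut into triangles by joining every hull vertex to a symbolic
vertex at infinity, so that a point outside the convex hull lies in an (unbounded) triangle too. -/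

/-- Vertices of a triangulation: points, and the vertex at infinity. -/
inductive Vertex : Type
  | pt (p : Point)
  | inf

/-- A triangulation as a half-edge structure: `M x y = some z` means that `x y z`, in
counterclockwise order, is the triangle to the left of the directed edge `x → y`. The triangle
`x y ∞` lies to the left of the hull edge `x → y`, which has the point set on its right. -/
def Mesh : Type := Vertex → Vertex → Option Vertex

/-- The structure without any edge. -/
def emptyMesh : Mesh := fun _ _ => none

open Classical in
/-- Set the triangle to the left of a single directed edge. -/
noncomputable def Mesh.set (M : Mesh) (x y : Vertex) (z : Option Vertex) : Mesh :=
  fun x' y' => if x' = x ∧ y' = y then z else M x' y'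

/-- Record the counterclockwise triangle `x y z` at its three directed edges. -/
noncomputable def Mesh.addTriangle (M : Mesh) (x y z : Vertex) : Mesh :=
  ((M.set x y (some z)).set y z (some x)).set z x (some y)

/-- The point `p` lies strictly inside the circumcircle of the counterclockwise triangle `x y z`;
the circumdisk of an unbounded triangle `x y ∞` is the open half-plane to the left of `x → y`. -/
def Conflict : Vertex → Vertex → Vertex → Point → Prop
  | .pt a, .pt b, .pt c, p => 0 < inCircle a b c p
  | .pt a, .pt b, .inf, p => 0 < orient a b p
  | .inf, .pt a, .pt b, p => 0 < orient a b p
  | .pt b, .inf, .pt a, p => 0 < orient a b p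
  | _, _, _, _ => False

/-! ## Iterating a step until it halts -/

/-- The number of steps made from `s` until the first halted state. -/
noncomputable def haltTime {σ : Type*} (halted : σ → Prop) (step : σ → σ) (s : σ) : ℕ :=
  sInf {n : ℕ | halted (step^[n] s)}

/-- The first halted state reached from `s`. -/
noncomputable def haltState {σ : Type*} (halted : σ → Prop) (step : σ → σ) (s : σ) : σ :=
  step^[haltTime halted step s] s

/-! ## Point location: the straight walk

To locate `p`, the algorithm starts at the last inserted point `q` and walks through the triangles
met by the segment from `q` to `p`. The state of the walk is a directed edge `a → b`, the current
triangle being the one to its left. -/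

open Classical in
/-- The edge where the walk from the vertex `q` towards `p` starts: a hull edge at `q` that is
visible from `p` (the current triangle then is unbounded and contains `p`), if there is one, and
otherwise the edge opposite to `q` in the triangle at `q` that the segment from `q` to `p` enters. -/
noncomputable def startEdge (M : Mesh) (q p : Point) : Point × Point :=
  if h : ∃ b : Point, M .inf (.pt q) = some (.pt b) ∧ 0 < orient q b p then (q, h.choose)
  else if h : ∃ a : Point, M (.pt q) .inf = some (.pt a) ∧ 0 < orient a q p then (h.choose, q)
  else if h : ∃ e : Point × Point, M (.pt q) (.pt e.1) = some (.pt e.2) ∧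
      0 < orient q e.1 p ∧ 0 < orient q p e.2 then h.choose
  else (q, q)

/-- The walk ends when the orientation test shows `p` to the left of the edge `e`: the current
triangle, to the left of `e`, contains `p`. -/
def Located (p : Point) (e : Point × Point) : Prop := 0 < orient e.1 e.2 p

open Classical in
/-- A navigation operation: cross the edge `a b`. If the triangle on its other side is unbounded, it
contains `p`; otherwise let `z` be its third vertex, and continue with the one of its edges `a z`,
`z b` that is met by the line from `q` to `p`. -/
noncomputable def crossEdge (M : Mesh) (q p : Point) (e : Point × Point) : Point × Point :=
  match M (.pt e.2) (.pt e.1) with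
  | some (.pt z) => if 0 < orient q p z then (e.1, z) else (z, e.2)
  | some .inf => (e.2, e.1)
  | none => e

/-- The number of navigation operations made to locate `p` from the last inserted point `q`. -/
noncomputable def navOps (M : Mesh) (q p : Point) : ℕ :=
  haltTime (Located p) (crossEdge M q p) (startEdge M q p)

/-- An edge of the triangle that contains `p`, with that triangle to its left. -/
noncomputable def locate (M : Mesh) (q p : Point) : Point × Point :=
  haltState (Located p) (crossEdge M q p) (startEdge M q p)

/-! ## Update: insertion of the point, and flips -/

/-- State of the update: the triangulation, the edges `x → y` opposite to the new point (in the
triangle `x y p`) that are still to be tested, and the number of flips made so far. -/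
structure FlipState where
  mesh : Mesh
  todo : List (Vertex × Vertex)
  flips : ℕ

/-- Replace the common edge `x y` of the triangles `x y p` and `y x z` by the edge `p z`. -/
noncomputable def Mesh.flip (M : Mesh) (p x y z : Vertex) : Mesh :=
  (((M.set x y none).set y x none).addTriangle x z p).addTriangle z y p

open Classical in
/-- Test the next edge `x y`. It is invalid if `p` lies strictly inside the circumcircle of the
triangle on its other side; then flip it and test the two new edges opposite to `p`. -/
noncomputable def flipStep (p : Point) (s : FlipState) : FlipState :=
  match s.todo with
  | [] => s
  | (x, y) :: rest =>
    match s.mesh y x with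
    | some z =>
      if Conflict y x z p then
        ⟨s.mesh.flip (.pt p) x y z, (x, z) :: (z, y) :: rest, s.flips + 1⟩
      else ⟨s.mesh, rest, s.flips⟩
    | none => ⟨s.mesh, rest, s.flips⟩

/-- Join the new point `p` to the three vertices of the triangle `x y z`, and schedule the edges of
that triangle for testing. -/
noncomputable def split (M : Mesh) (p : Point) (x y z : Vertex) : FlipState :=
  ⟨((M.addTriangle x y (.pt p)).addTriangle y z (.pt p)).addTriangle z x (.pt p),
    [(x, y), (y, z), (z, x)], 0⟩

/-- The state after the insertion of `p` into the triangle to the left of `e`, when all invalid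
edges have been flipped. -/
noncomputable def update (M : Mesh) (p : Point) (e : Point × Point) : FlipState :=
  match M (.pt e.1) (.pt e.2) with
  | some z => haltState (fun s => s.todo = []) (flipStep p) (split M p (.pt e.1) (.pt e.2) z)
  | none => ⟨M, [], 0⟩

/-! ## The incremental algorithm and its operations -/

/-- State of the incremental algorithm: no point yet, a single point, or (from the second point on)
a triangulation together with the last inserted point. -/
inductive State : Type
  | empty
  | single (a : Point)
  | mesh (M : Mesh) (last : Point)

/-- Insert one point; the second component is the number of navigation and flip operations. Two
points `a`, `b` yield the two unbounded triangles `a b ∞` and `b a ∞`. -/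
noncomputable def insertPoint : State → Point → State × ℕ
  | .empty, p => (.single p, 0)
  | .single a, p =>
    (.mesh ((emptyMesh.addTriangle (.pt a) (.pt p) .inf).addTriangle (.pt p) (.pt a) .inf) p, 0)
  | .mesh M q, p =>
    (.mesh (update M p (locate M q p)).mesh p, navOps M q p + (update M p (locate M q p)).flips)

/-- Total number of operations made when the points of a list are inserted one by one. -/
noncomputable def opsFrom : State → List Point → ℕ
  | _, [] => 0
  | s, p :: l => (insertPoint s p).2 + opsFrom (insertPoint s p).1 l

/-- Total number of navigation and flip operations made by the incremental algorithm on a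
sequence. -/
noncomputable def ops (S : List Point) : ℕ := opsFrom .empty S

/-! ## Amortized D-linear runs -/

/-- For each `i`, at most `k * i` operations are made on the first `i` points. -/
def IsAmortizedDLinear (k : ℕ) (S : List Point) : Prop :=
  ∀ i : ℕ, i ≤ S.length → ops (S.take i) ≤ k * i

/-- `P` cuts `S` into nonempty amortized `k`-D-linear runs of consecutive points. -/
def IsRunPartition (k : ℕ) (S : List Point) (P : List (List Point)) : Prop :=
  P.flatten = S ∧ ∀ R ∈ P, R ≠ [] ∧ IsAmortizedDLinear k R

/-- Amortized greedy partitioning in progress: `s` is the state of the incremental algorithm on the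
current run `cur`, and `credit` the number of unused operations. The next point joins the current
run if its insertion makes at most `k + credit` operations, and otherwise starts a new run. -/
noncomputable def greedyFrom (k : ℕ) : State → ℕ → List Point → List Point → List (List Point)
  | _, _, cur, [] => [cur]
  | s, credit, cur, p :: l =>
    if (insertPoint s p).2 ≤ k + credit then
      greedyFrom k (insertPoint s p).1 (k + credit - (insertPoint s p).2) (cur ++ [p]) l
    else
      cur :: greedyFrom k (insertPoint .empty p).1 (k - (insertPoint .empty p).2) [p] l

/-- The list of runs yielded by amortized greedy partitioning with threshold `k`. -/
noncomputable def amortizedGreedy (k : ℕ) : List Point → List (List Point)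
  | [] => []
  | p :: l => greedyFrom k (insertPoint .empty p).1 (k - (insertPoint .empty p).2) [p] l

/-- The points are distinct and no three of them are collinear. -/
def InGeneralPosition (S : List Point) : Prop :=
  S.Nodup ∧ ∀ a ∈ S, ∀ b ∈ S, ∀ c ∈ S, a ≠ b → a ≠ c → b ≠ c →
    ¬ Collinear ℝ ({a, b, c} : Set Point)

end DelaunayRuns

namespace DelaunayRuns

/-! ## Running the update and the insertion -/

/-! Two parabolas meet at (2, 4). On suitable arcs of either one, traversed in a suitable order,
every new point lies in the circumdisks of all bounded triangles present, which form a fan at the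
last point (`IsConflictSeq`, `IsFan`). The insertion then flips every fan triangle, so m + 2 points
cost m(m - 1)/2 flips and no navigation (`IsConflictSeq.two_mul_ops`). Comparison with k(m + 2)
shows that such a run is amortized linear up to exactly 2k + 4 points.

The sequence `hardSeq` has 2k + 4 points on the second parabola, ending at (0, 1), followed by
points of the first parabola with abscissas decreasing from 2 to 0. Since (2, 4) lies on both
curves, the first 2k + 5 points are a conflict sequence. Greedy therefore takes exactly the first 2k
+ 4 points, and with them (0, 1). All later runs lie on the first parabola, again a conflict
sequence, so none exceeds 2k + 4 points (`length_le_mul_length_greedyFrom`).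

Cutting one point earlier lets (0, 1) open the second run. It then stays the apex of every triangle,
and no insertion needs an operation (`ops_apex_parabola`), so two runs suffice. One run is
impossible because of the first 2k + 5 points. -/

theorem haltTime_eq_zero {σ : Type*} {halted : σ → Prop} {step : σ → σ} {s : σ} (h : halted s) :
    haltTime halted step s = 0 :=
  Nat.sInf_eq_zero.2 (Or.inl h)

theorem haltState_eq_self {σ : Type*} {halted : σ → Prop} {step : σ → σ} {s : σ} (h : halted s) :
    haltState halted step s = s := by
  simp [haltState, haltTime_eq_zero h]

/-- If the halted states are fixed points, any halted state that is reached is the first one. -/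
theorem haltState_eq_of_iterate {σ : Type*} {halted : σ → Prop} {step : σ → σ}
    (hfix : ∀ s, halted s → step s = s) {s t : σ} {n : ℕ} (hn : step^[n] s = t) (ht : halted t) :
    haltState halted step s = t := by
  have hmem : haltTime halted step s ∈ {n : ℕ | halted (step^[n] s)} :=
    Nat.sInf_mem ⟨n, by simpa [hn] using ht⟩
  have hle : haltTime halted step s ≤ n := Nat.sInf_le (by simpa [hn] using ht)
  have hfix' := Function.iterate_fixed (hfix _ hmem) (n - haltTime halted step s)
  rw [← Function.iterate_add_apply, Nat.sub_add_cancel hle, hn] at hfix'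
  exact hfix'.symm

/-- The update of `p` leads from the state `s` to the state `t`. -/
def Reaches (p : Point) (s t : FlipState) : Prop := ∃ n : ℕ, (flipStep p)^[n] s = t

theorem Reaches.trans {p : Point} {s t u : FlipState} (h₁ : Reaches p s t) (h₂ : Reaches p t u) :
    Reaches p s u := by
  obtain ⟨n, rfl⟩ := h₁
  obtain ⟨m, rfl⟩ := h₂
  exact ⟨m + n, Function.iterate_add_apply _ _ _ _⟩

theorem reaches_flip {p : Point} {M : Mesh} {x y z : Vertex} (rest : List (Vertex × Vertex))
    (n : ℕ) (hz : M y x = some z) (hc : Conflict y x z p) :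
    Reaches p ⟨M, (x, y) :: rest, n⟩
      ⟨M.flip (.pt p) x y z, (x, z) :: (z, y) :: rest, n + 1⟩ :=
  ⟨1, by simp [flipStep, hz, hc]⟩

theorem reaches_skip {p : Point} {M : Mesh} {x y z : Vertex} (rest : List (Vertex × Vertex))
    (n : ℕ) (hz : M y x = some z) (hc : ¬ Conflict y x z p) :
    Reaches p ⟨M, (x, y) :: rest, n⟩ ⟨M, rest, n⟩ :=
  ⟨1, by simp [flipStep, hz, hc]⟩

/-- A state with an empty list of pending edges is fixed by `flipStep`, so reaching one determines
the result without counting steps. -/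
theorem update_eq_of_reaches {M M' : Mesh} {p : Point} {e : Point × Point} {v : Vertex} {n : ℕ}
    (hv : M (.pt e.1) (.pt e.2) = some v)
    (h : Reaches p (split M p (.pt e.1) (.pt e.2) v) ⟨M', [], n⟩) :
    update M p e = ⟨M', [], n⟩ := by
  obtain ⟨m, hm⟩ := h
  simp only [update, hv]
  refine haltState_eq_of_iterate ?_ hm rfl
  rintro ⟨M, _, n⟩ rfl
  rfl

/-- The mesh is a function, so the point picked by choice can only be `b`. -/
theorem startEdge_of_visible {M : Mesh} {q b p : Point} (hb : M .inf (.pt q) = some (.pt b))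
    (ho : 0 < orient q b p) : startEdge M q p = (q, b) := by
  have h : ∃ b : Point, M .inf (.pt q) = some (.pt b) ∧ 0 < orient q b p := ⟨b, hb, ho⟩
  have hc : h.choose = b := by
    have := h.choose_spec.1.symm.trans hb
    simpa using this
  rw [startEdge, dif_pos h, hc]

/-- Insertion of a point that sees a hull edge at the last inserted point. -/
theorem insertPoint_of_visible {M M' : Mesh} {q b p : Point} {n : ℕ}
    (hb : M .inf (.pt q) = some (.pt b)) (ho : 0 < orient q b p)
    (he : M (.pt q) (.pt b) = some .inf)
    (h : Reaches p (split M p (.pt q) (.pt b) .inf) ⟨M', [], n⟩) :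
    insertPoint (.mesh M q) p = (.mesh M' p, n) := by
  have hs := startEdge_of_visible hb ho
  -- The walk halts at its start edge, hence no navigation.
  have hL : Located p (startEdge M q p) := by rw [hs]; exact ho
  have hl : locate M q p = (q, b) := by rw [locate, haltState_eq_self hL, hs]
  have hnav : navOps M q p = 0 := haltTime_eq_zero hL
  have hu : update M p (q, b) = ⟨M', [], n⟩ := update_eq_of_reaches he h
  simp [insertPoint, hl, hnav, hu]

/-! ### State and cost after a list of insertions -/

/-- The state of the incremental algorithm after the insertion of the points of a list. -/
noncomputable def stateFrom (s : State) (l : List Point) : State :=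
  l.foldl (fun s p => (insertPoint s p).1) s

theorem stateFrom_append_singleton (s : State) (l : List Point) (p : Point) :
    stateFrom s (l ++ [p]) = (insertPoint (stateFrom s l) p).1 := by
  simp [stateFrom]

theorem opsFrom_append_singleton (s : State) (l : List Point) (p : Point) :
    opsFrom s (l ++ [p]) = opsFrom s l + (insertPoint (stateFrom s l) p).2 := by
  induction l generalizing s with
  | nil => simp [opsFrom, stateFrom]
  | cons a l ih =>
    simp only [List.cons_append, opsFrom, ih, stateFrom, List.foldl_cons]
    ring

theorem ops_append_singleton (l : List Point) (p : Point) :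
    ops (l ++ [p]) = ops l + (insertPoint (stateFrom .empty l) p).2 :=
  opsFrom_append_singleton _ _ _

/-- The mesh of two points. -/
noncomputable def edgeMesh (a b : Point) : Mesh :=
  (emptyMesh.addTriangle (.pt a) (.pt b) .inf).addTriangle (.pt b) (.pt a) .inf

theorem stateFrom_pair (a b : Point) : stateFrom .empty [a, b] = .mesh (edgeMesh a b) b :=
  rfl

theorem ops_pair (a b : Point) : ops [a, b] = 0 := rfl

/-! ## Sequences in which every new point is joined to all earlier ones -/

theorem orient_swap (a b c : Point) : orient b a c = -orient a b c := by
  simp only [orient]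
  ring

/-- Points on a convex arc, each of which lies inside the circumcircles of all triangles formed by
the point before it and two earlier ones. -/
structure IsConflictSeq (q : ℕ → Point) : Prop where
  injective : Function.Injective q
  orient_neg : ∀ i j l, i < j → j < l → orient (q i) (q j) (q l) < 0
  -- The points turn clockwise, so `q i`, `q l`, `q j` is the counterclockwise order that the
  -- incircle test expects.
  inCircle_pos : ∀ i j l r, i < j → j < l → l < r → 0 < inCircle (q i) (q l) (q j) (q r)

/-- The mesh of `q 0, …, q (m + 1)`: a fan of triangles with apex `q (m + 1)`. -/
structure IsFan (q : ℕ → Point) (m : ℕ) (M : Mesh) : Prop where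
  hull : ∀ i, i < m + 1 → M (.pt (q i)) (.pt (q (i + 1))) = some .inf
  fan : ∀ i, i < m → M (.pt (q i)) (.pt (q (m + 1))) = some (.pt (q (i + 1)))
  chord : M (.pt (q (m + 1))) (.pt (q 0)) = some .inf
  inf_last : M .inf (.pt (q (m + 1))) = some (.pt (q 0))
  last_inf : M (.pt (q (m + 1))) .inf = some (.pt (q m))
  inf_first : M .inf (.pt (q 0)) = some (.pt (q 1))

theorem IsConflictSeq.isFan_edgeMesh {q : ℕ → Point} (hq : IsConflictSeq q) :
    IsFan q 0 (edgeMesh (q 0) (q 1)) := by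
  have h01 : q 0 ≠ q 1 := fun h => absurd (hq.injective h) (by simp)
  constructor <;>
    simp [edgeMesh, Mesh.addTriangle, Mesh.set, h01, h01.symm]

/-- The flips made from the edge `q n, q i` on, when `p = q (n + 1)` is inserted into the fan with
apex `q n`. -/
theorem IsConflictSeq.reaches_cascade {q : ℕ → Point} (hq : IsConflictSeq q) (n d : ℕ) :
    ∀ (i : ℕ) (M : Mesh) (rest : List (Vertex × Vertex)) (c : ℕ), i + d + 1 = n →
      (∀ j, j < n → M (.pt (q j)) (.pt (q (j + 1))) = some .inf) →
      (∀ j, i ≤ j → j + 1 < n → M (.pt (q j)) (.pt (q n)) = some (.pt (q (j + 1)))) →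
      (∀ j, j < i → M (.pt (q j)) (.pt (q (n + 1))) = some (.pt (q (j + 1)))) →
      M (.pt (q i)) (.pt (q (n + 1))) = some (.pt (q n)) →
      ∃ M' : Mesh,
        Reaches (q (n + 1)) ⟨M, (.pt (q n), .pt (q i)) :: rest, c⟩ ⟨M', rest, c + d⟩ ∧
        (∀ j, j < n → M' (.pt (q j)) (.pt (q (j + 1))) = some .inf) ∧
        (∀ j, j < n → M' (.pt (q j)) (.pt (q (n + 1))) = some (.pt (q (j + 1)))) ∧
        M' (.pt (q (n + 1))) (.pt (q 0)) = M (.pt (q (n + 1))) (.pt (q 0)) ∧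
        M' (.pt (q n)) (.pt (q (n + 1))) = M (.pt (q n)) (.pt (q (n + 1))) ∧
        ∀ a, M' .inf a = M .inf a ∧ M' a .inf = M a .inf := by
  have hskip : ∀ j, j < n →
      ¬ Conflict (.pt (q j)) (.pt (q (j + 1))) .inf (q (n + 1)) := fun j hj =>
    not_lt.2 (hq.orient_neg j (j + 1) (n + 1) (by omega) (by omega)).le
  induction d with
  | zero =>
    intro i M rest c hi hull fan done last
    -- The fan is exhausted: the tested edge is the hull edge between the two latest old points,
    -- which `p` does not see.
    obtain rfl : n = i + 1 := by omega
    refine ⟨M, reaches_skip _ _ (hull i (by omega)) (hskip i (by omega)), hull, ?_, rfl, rfl,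
      fun a => ⟨rfl, rfl⟩⟩
    intro j hj
    rcases Nat.lt_succ_iff_lt_or_eq.1 hj with h | rfl
    · exact done j h
    · exact last
  | succ d ih =>
    intro i M rest c hi hull fan done last
    have hc : Conflict (.pt (q i)) (.pt (q n)) (.pt (q (i + 1))) (q (n + 1)) :=
      hq.inCircle_pos i (i + 1) n (n + 1) (by omega) (by omega) (by omega)
    have happ : ∀ a b : ℕ, M.flip (.pt (q (n + 1))) (.pt (q n)) (.pt (q i)) (.pt (q (i + 1)))
        (.pt (q a)) (.pt (q b)) =
        if a = n + 1 ∧ b = i + 1 then some (.pt (q i))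
        else if a = i ∧ b = n + 1 then some (.pt (q (i + 1)))
        else if a = i + 1 ∧ b = i then some (.pt (q (n + 1)))
        else if a = n + 1 ∧ b = n then some (.pt (q (i + 1)))
        else if a = i + 1 ∧ b = n + 1 then some (.pt (q n))
        else if a = n ∧ b = i + 1 then some (.pt (q (n + 1)))
        else if a = i ∧ b = n then none
        else if a = n ∧ b = i then none
        else M (.pt (q a)) (.pt (q b)) := by
      intro a b
      simp only [Mesh.flip, Mesh.addTriangle, Mesh.set, Vertex.pt.injEq, hq.injective.eq_iff]
    -- Of the two edges scheduled by the flip, `q n, q (i + 1)` borders the next fan triangle and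
    -- continues the cascade; `q (i + 1), q i` is a hull edge and is skipped afterwards.
    obtain ⟨M', hr, hull', done', hp0, hnp, hinf⟩ := ih (i + 1)
      (M.flip (.pt (q (n + 1))) (.pt (q n)) (.pt (q i)) (.pt (q (i + 1))))
      ((.pt (q (i + 1)), .pt (q i)) :: rest) (c + 1) (by omega)
      (fun j hj => by
        rw [happ]
        repeat rw [if_neg (by omega)]
        exact hull j hj)
      (fun j hj hjn => by
        rw [happ]
        repeat rw [if_neg (by omega)]
        exact fan j (by omega) hjn)
      (fun j hj => by
        rw [happ]
        rcases Nat.lt_succ_iff_lt_or_eq.1 hj with h | rfl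
        · repeat rw [if_neg (by omega)]
          exact done j h
        · rw [if_neg (by omega), if_pos (by omega)])
      (by
        rw [happ]
        iterate 4 rw [if_neg (by omega)]
        rw [if_pos (by omega)])
    refine ⟨M', ?_, hull', done', ?_, ?_, fun a => ?_⟩
    · refine (reaches_flip _ _ (fan i le_rfl (by omega)) hc).trans (hr.trans ?_)
      rw [show c + (d + 1) = c + 1 + d by omega]
      exact reaches_skip _ _ (hull' i (by omega)) (hskip i (by omega))
    · rw [hp0, happ]
      repeat rw [if_neg (by omega)]
    · rw [hnp, happ]
      repeat rw [if_neg (by omega)]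
    · rw [(hinf a).1, (hinf a).2]
      simp [Mesh.flip, Mesh.addTriangle, Mesh.set]

/-- Inserting the next point into a fan makes it the apex, at the cost of one flip for every
triangle. -/
theorem IsConflictSeq.insertPoint_fan {q : ℕ → Point} (hq : IsConflictSeq q) {m : ℕ} {M : Mesh}
    (hM : IsFan q m M) :
    ∃ M', insertPoint (.mesh M (q (m + 1))) (q (m + 2)) = (.mesh M' (q (m + 2)), m) ∧
      IsFan q (m + 1) M' := by
  have happ : ∀ a b : ℕ, (split M (q (m + 2)) (.pt (q (m + 1))) (.pt (q 0)) .inf).mesh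
      (.pt (q a)) (.pt (q b)) =
      if a = m + 2 ∧ b = m + 1 then some (.pt (q 0))
      else if a = 0 ∧ b = m + 2 then some (.pt (q (m + 1)))
      else if a = m + 1 ∧ b = 0 then some (.pt (q (m + 2)))
      else if a = m + 2 ∧ b = 0 then some .inf
      else if a = m + 1 ∧ b = m + 2 then some .inf
      else M (.pt (q a)) (.pt (q b)) := by
    intro a b
    simp only [split, Mesh.addTriangle, Mesh.set, Vertex.pt.injEq, hq.injective.eq_iff,
      reduceCtorEq, false_and, and_false, if_false]
    split_ifs <;> first | rfl | omega
  have hne : ∀ a b : ℕ, q a = q b ↔ a = b := fun a b => hq.injective.eq_iff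
  obtain ⟨M', hr, hull, done, hp0, hnp, hinf⟩ := hq.reaches_cascade (m + 1) m 0
    (split M (q (m + 2)) (.pt (q (m + 1))) (.pt (q 0)) .inf).mesh
    [(.pt (q 0), .inf), (.inf, .pt (q (m + 1)))] 0 (by omega)
    (fun j hj => by
      rw [happ]
      repeat rw [if_neg (by omega)]
      exact hM.hull j hj)
    (fun j _ hj => by
      rw [happ]
      repeat rw [if_neg (by omega)]
      exact hM.fan j (by omega))
    (fun j hj => absurd hj (by omega))
    (by rw [happ, if_neg (by omega), if_pos (by omega)])
  have h0 : M' .inf (.pt (q 0)) = some (.pt (q 1)) := by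
    rw [(hinf _).1, ← hM.inf_first]
    simp [split, Mesh.addTriangle, Mesh.set, hne]
  have hl : M' (.pt (q (m + 1))) .inf = some (.pt (q m)) := by
    rw [(hinf _).2, ← hM.last_inf]
    simp [split, Mesh.addTriangle, Mesh.set, hne]
  refine ⟨M', insertPoint_of_visible hM.inf_last ?_ hM.chord (hr.trans ?_), fun j hj => ?_, done,
    ?_, ?_, ?_, h0⟩
  · rw [orient_swap]
    exact neg_pos.2 (hq.orient_neg 0 (m + 1) (m + 2) (by omega) (by omega))
  · rw [Nat.zero_add]
    refine (reaches_skip _ _ h0 ?_).trans (reaches_skip _ _ hl ?_)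
    · exact not_lt.2 (hq.orient_neg 0 1 (m + 2) (by omega) (by omega)).le
    · exact not_lt.2 (hq.orient_neg m (m + 1) (m + 2) (by omega) (by omega)).le
  · rcases Nat.lt_succ_iff_lt_or_eq.1 hj with h | rfl
    · exact hull j h
    · rw [hnp, happ]
      iterate 4 rw [if_neg (by omega)]
      rw [if_pos (by omega)]
  · rw [hp0, happ]
    iterate 3 rw [if_neg (by omega)]
    rw [if_pos (by omega)]
  · rw [(hinf _).1]
    simp [split, Mesh.addTriangle, Mesh.set, hne]
  · rw [(hinf _).2]
    simp [split, Mesh.addTriangle, Mesh.set]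

/-! ### Initial segments of a sequence and their cost -/

/-- The first `n` points of a sequence. -/
def initial (q : ℕ → Point) (n : ℕ) : List Point := (List.range n).map q

@[simp]
theorem length_initial (q : ℕ → Point) (n : ℕ) : (initial q n).length = n := by simp [initial]

theorem initial_succ (q : ℕ → Point) (n : ℕ) : initial q (n + 1) = initial q n ++ [q n] := by
  simp [initial, List.range_succ]

theorem take_initial (q : ℕ → Point) {i n : ℕ} (h : i ≤ n) :
    (initial q n).take i = initial q i := by
  rw [initial, ← List.map_take, List.take_range, min_eq_left h, initial]

theorem initial_add (q : ℕ → Point) (m n : ℕ) :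
    initial q (m + n) = initial q m ++ initial (fun i => q (m + i)) n := by
  simp [initial, List.range_add, Function.comp_def]

/-- The cost of a sequence in which every new point is joined to all earlier ones. -/
theorem IsConflictSeq.two_mul_ops {q : ℕ → Point} (hq : IsConflictSeq q) (m : ℕ) :
    2 * ops (initial q (m + 2)) + m = m * m := by
  -- The new point after a fan of i triangles costs i flips; the doubled identity avoids subtraction
  -- and division.
  suffices ∃ M, stateFrom .empty (initial q (m + 2)) = .mesh M (q (m + 1)) ∧ IsFan q m M ∧
      2 * ops (initial q (m + 2)) + m = m * m from this.choose_spec.2.2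
  induction m with
  | zero => exact ⟨_, rfl, hq.isFan_edgeMesh, rfl⟩
  | succ m ih =>
    obtain ⟨M, hs, hM, ho⟩ := ih
    obtain ⟨M', hi, hM'⟩ := hq.insertPoint_fan hM
    refine ⟨M', ?_, hM', ?_⟩
    · rw [initial_succ, stateFrom_append_singleton, hs, hi]
    · rw [initial_succ, ops_append_singleton, hs, hi]
      linarith

/-- Lets the bound on run length apply wherever greedy restarts. -/
theorem IsConflictSeq.comp_add {q : ℕ → Point} (hq : IsConflictSeq q) (j : ℕ) :
    IsConflictSeq fun i => q (j + i) where
  injective _ _ h := Nat.add_left_cancel (hq.injective h)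
  orient_neg _ _ _ h₁ h₂ := hq.orient_neg _ _ _ (by omega) (by omega)
  inCircle_pos _ _ _ _ h₁ h₂ h₃ := hq.inCircle_pos _ _ _ _ (by omega) (by omega) (by omega)

/-! ## Two parabolas -/

/-- The point of the parabola above `t`. -/
def parabola (t : ℝ) : Point := (t, t ^ 2)

/-- The point above `t` of a second parabola, which opens downwards and passes through `(0, 1)` and
the point `(2, 4)` of the first one. -/
noncomputable def cap (t : ℝ) : Point := (t, 1 + 5 / 2 * t - t ^ 2 / 2)

theorem parabola_injective : Function.Injective parabola := fun _ _ h => congrArg Prod.fst h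

theorem cap_injective : Function.Injective cap := fun _ _ h => congrArg Prod.fst h

theorem orient_parabola (a b c : ℝ) :
    orient (parabola a) (parabola b) (parabola c) = (b - a) * (c - a) * (c - b) := by
  simp only [orient, parabola]
  ring

/-- The determinant is antisymmetric, so the Vandermonde product splits off. The remaining factor is
the sum of the abscissas, whose sign is constant on each side of the axis. -/
theorem inCircle_parabola (a b c d : ℝ) :
    inCircle (parabola a) (parabola b) (parabola c) (parabola d) =
      (a - d) * (b - d) * (c - d) * ((b - a) * (c - a) * (c - b)) * (a + b + c + d) := by
  simp only [inCircle, parabola]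
  ring

theorem orient_cap (a b c : ℝ) :
    orient (cap a) (cap b) (cap c) = -((b - a) * (c - a) * (c - b)) / 2 := by
  simp only [orient, cap]
  ring

/-- Same factorization, with abscissas measured from the axis at 5/2; four of them give the 10. -/
theorem inCircle_cap (a b c d : ℝ) :
    inCircle (cap a) (cap b) (cap c) (cap d) =
      (a - d) * (b - d) * (c - d) * ((b - a) * (c - a) * (c - b)) * (10 - (a + b + c + d)) / 8 := by
  simp only [inCircle, cap]
  ring

/-- The line through the parabola points above `a` and `b` meets the vertical axis at height `-a *
b`, which is `a * b + 1` below (0, 1). -/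
theorem orient_zero_one_parabola (a b : ℝ) :
    orient (0, 1) (parabola a) (parabola b) = (b - a) * (a * b + 1) := by
  simp only [orient, parabola]
  ring

/-- The cofactor of the Vandermonde product has only nonnegative terms when the abscissas are
positive, so their order alone decides the sign. -/
theorem inCircle_zero_one_parabola (a b c : ℝ) :
    inCircle (0, 1) (parabola a) (parabola b) (parabola c) =
      -((b - a) * (c - a) * (c - b) *
        (a * b * c * (a + b + c) + (a ^ 2 + b ^ 2 + c ^ 2 + a * b + b * c + c * a))) := by
  simp only [inCircle, parabola]
  ring

/-- On the right half of the parabola, points in decreasing order conflict. -/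
theorem isConflictSeq_parabola {x : ℕ → ℝ} (hx : StrictAnti x) (hpos : ∀ i, 0 < x i) :
    IsConflictSeq fun i => parabola (x i) where
  injective := parabola_injective.comp hx.injective
  orient_neg i j l hij hjl := by
    have h₁ := sub_neg.2 (hx hij)
    have h₂ := sub_neg.2 (hx hjl)
    have h₃ := sub_neg.2 (hx (hij.trans hjl))
    rw [orient_parabola]
    exact mul_neg_of_pos_of_neg (mul_pos_of_neg_of_neg h₁ h₃) h₂
  inCircle_pos i j l r hij hjl hlr := by
    have h₁ := sub_pos.2 (hx (hij.trans (hjl.trans hlr)))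
    have h₂ := sub_pos.2 (hx hlr)
    have h₃ := sub_pos.2 (hx (hjl.trans hlr))
    have h₄ := sub_neg.2 (hx (hij.trans hjl))
    have h₅ := sub_neg.2 (hx hij)
    have h₆ := sub_pos.2 (hx hjl)
    rw [inCircle_parabola]
    have := hpos i
    have := hpos j
    have := hpos l
    have := hpos r
    exact mul_pos (mul_pos (mul_pos (mul_pos h₁ h₂) h₃)
      (mul_pos (mul_pos_of_neg_of_neg h₄ h₅) h₆)) (by positivity)

/-- On the left half of the second parabola, points in increasing order conflict. -/
theorem isConflictSeq_cap {u : ℕ → ℝ} (hu : StrictMono u) (hlt : ∀ i, u i < 5 / 2) :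
    IsConflictSeq fun i => cap (u i) where
  injective := cap_injective.comp hu.injective
  orient_neg i j l hij hjl := by
    have h₁ := sub_pos.2 (hu hij)
    have h₂ := sub_pos.2 (hu hjl)
    have h₃ := sub_pos.2 (hu (hij.trans hjl))
    rw [orient_cap]
    have := mul_pos (mul_pos h₁ h₃) h₂
    linarith
  inCircle_pos i j l r hij hjl hlr := by
    have h₁ := sub_neg.2 (hu (hij.trans (hjl.trans hlr)))
    have h₂ := sub_neg.2 (hu hlr)
    have h₃ := sub_neg.2 (hu (hjl.trans hlr))
    have h₄ := sub_pos.2 (hu (hij.trans hjl))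
    have h₅ := sub_pos.2 (hu hij)
    have h₆ := sub_neg.2 (hu hjl)
    rw [inCircle_cap]
    have h₇ : 0 < 10 - (u i + u l + u j + u r) := by
      linarith [hlt i, hlt j, hlt l, hlt r]
    exact div_pos (mul_pos (mul_pos_of_neg_of_neg
      (mul_neg_of_pos_of_neg (mul_pos_of_neg_of_neg h₁ h₂) h₃)
      (mul_neg_of_pos_of_neg (mul_pos h₄ h₅) h₆)) h₇) (by norm_num)

/-! ## The run that starts at `(0, 1)` -/

/-- The part of the mesh of `(0, 1), q 0, …, q (m + 1)` near the last inserted point, if all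
triangles have the apex `(0, 1)`. -/
structure IsApexFan (q : ℕ → Point) (m : ℕ) (M : Mesh) : Prop where
  last_apex : M (.pt (q (m + 1))) (.pt (0, 1)) = some .inf
  inf_last : M .inf (.pt (q (m + 1))) = some (.pt (0, 1))
  apex_last : M (.pt (0, 1)) (.pt (q (m + 1))) = some (.pt (q m))
  inf_apex : M .inf (.pt (0, 1)) = some (.pt (q 0))
  last_inf : M (.pt (q (m + 1))) .inf = some (.pt (q m))

/-- Without flips, inserting `p` into the unbounded triangle at the hull edge `a b` adds the
triangle `a b p`. -/
theorem insertPoint_of_visible_of_valid {M : Mesh} {a b p : Point} {u v w : Vertex}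
    (hab : a ≠ b) (hap : a ≠ p) (hbp : b ≠ p)
    (hb : M .inf (.pt a) = some (.pt b)) (ho : 0 < orient a b p)
    (he : M (.pt a) (.pt b) = some .inf)
    (hu : M (.pt b) (.pt a) = some u) (hu' : ¬ Conflict (.pt b) (.pt a) u p)
    (hv : M .inf (.pt b) = some v) (hv' : ¬ Conflict .inf (.pt b) v p)
    (hw : M (.pt a) .inf = some w) (hw' : ¬ Conflict (.pt a) .inf w p) :
    insertPoint (.mesh M a) p = (.mesh (split M p (.pt a) (.pt b) .inf).mesh p, 0) := by
  refine insertPoint_of_visible hb ho he ?_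
  refine (reaches_skip (z := u) _ _ ?_ hu').trans
    ((reaches_skip (z := v) _ _ ?_ hv').trans (reaches_skip (z := w) _ _ ?_ hw'))
  · simp [Mesh.addTriangle, Mesh.set, hab, hab.symm, hap, hbp, hu]
  · simp [Mesh.addTriangle, Mesh.set, hab.symm, hbp, hv]
  · simp [Mesh.addTriangle, Mesh.set, hab, hap, hw]

/-- After `(0, 1)`, the insertion of points of the parabola in decreasing order is free. -/
theorem ops_apex_parabola {x : ℕ → ℝ} (hx : StrictAnti x) (hpos : ∀ i, 0 < x i) (n : ℕ) :
    ops ((0, 1) :: initial (fun i => parabola (x i)) n) = 0 := by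
  have hne : ∀ i, parabola (x i) ≠ (0, 1) := fun i h => (hpos i).ne' (congrArg Prod.fst h)
  have hqq : ∀ i j, parabola (x i) = parabola (x j) ↔ i = j := fun i j =>
    (parabola_injective.comp hx.injective).eq_iff
  have hvis : ∀ i j, i < j → 0 < orient (parabola (x i)) (0, 1) (parabola (x j)) := by
    intro i j hij
    rw [orient_swap, orient_zero_one_parabola]
    nlinarith [hx hij, mul_pos (hpos i) (hpos j)]
  have hinv : ∀ i j, i < j → ¬ 0 < orient (0, 1) (parabola (x i)) (parabola (x j)) := by
    intro i j hij
    rw [← neg_neg (orient _ _ _), ← orient_swap]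
    linarith [hvis i j hij]
  -- The invariant needs a bounded triangle, so it starts at three points; shorter lists are free by
  -- definition.
  suffices ∀ m, ∃ M,
      stateFrom .empty ((0, 1) :: initial (fun i => parabola (x i)) (m + 2)) =
        .mesh M (parabola (x (m + 1))) ∧ IsApexFan (fun i => parabola (x i)) m M ∧
      ops ((0, 1) :: initial (fun i => parabola (x i)) (m + 2)) = 0 by
    match n with
    | 0 => rfl
    | 1 => rfl
    | m + 2 => exact (this m).choose_spec.2.2
  intro m
  induction m with
  | zero =>
    have hi := insertPoint_of_visible_of_valid (M := edgeMesh (0, 1) (parabola (x 0)))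
      (u := .inf) (v := .pt (parabola (x 0))) (w := .pt (0, 1)) (hne 0)
      (fun h => absurd ((hqq 0 1).1 h) (by simp)) (hne 1).symm
      (by simp [edgeMesh, Mesh.addTriangle, Mesh.set])
      (hvis 0 1 one_pos)
      (by simp [edgeMesh, Mesh.addTriangle, Mesh.set, hne, (hne _).symm])
      (by simp [edgeMesh, Mesh.addTriangle, Mesh.set, hne, (hne _).symm])
      (hinv 0 1 one_pos)
      (by simp [edgeMesh, Mesh.addTriangle, Mesh.set, (hne _).symm])
      (hinv 0 1 one_pos)
      (by simp [edgeMesh, Mesh.addTriangle, Mesh.set, hne])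
      (hinv 0 1 one_pos)
    have hl : (0, 1) :: initial (fun i => parabola (x i)) (0 + 2) =
      [(0, 1), parabola (x 0)] ++ [parabola (x 1)] := rfl
    refine ⟨(split (edgeMesh (0, 1) (parabola (x 0))) (parabola (x 1)) (.pt (parabola (x 0)))
      (.pt (0, 1)) .inf).mesh, ?_, ?_, ?_⟩
    · rw [hl, stateFrom_append_singleton, stateFrom_pair, hi]
    · constructor <;>
        simp [split, edgeMesh, Mesh.addTriangle, Mesh.set, hne, (hne _).symm, hqq]
    · rw [hl, ops_append_singleton, stateFrom_pair, ops_pair, hi, zero_add]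
  | succ m ih =>
    obtain ⟨M, hs, hM, ho⟩ := ih
    have hi := insertPoint_of_visible_of_valid (p := parabola (x (m + 2))) (hne (m + 1))
      (fun h => absurd ((hqq _ _).1 h) (by omega)) (hne (m + 2)).symm
      hM.inf_last (hvis _ _ (by omega)) hM.last_apex hM.apex_last ?_
      hM.inf_apex (hinv _ _ (by omega)) hM.last_inf ?_
    · refine ⟨(split M (parabola (x (m + 2))) (.pt (parabola (x (m + 1))))
        (.pt (0, 1)) .inf).mesh, ?_, ?_, ?_⟩
      · rw [initial_succ, ← List.cons_append, stateFrom_append_singleton, hs, hi]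
      · constructor <;>
          simp [split, Mesh.addTriangle, Mesh.set, hne, (hne _).symm, hqq, hM.inf_apex]
      · rw [initial_succ, ← List.cons_append, ops_append_singleton, hs, ho, hi, zero_add]
    · change ¬ 0 < inCircle _ _ _ _
      rw [inCircle_zero_one_parabola, not_lt, neg_nonpos]
      have h₁ := sub_pos.2 (hx (show m < m + 1 by omega))
      have h₂ := sub_neg.2 (hx (show m + 1 < m + 2 by omega))
      have h₃ := sub_neg.2 (hx (show m < m + 2 by omega))
      have := hpos m
      have := hpos (m + 1)
      have := hpos (m + 2)
      rw [mul_assoc (_ - _)]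
      exact mul_nonneg (mul_nonneg h₁.le (mul_nonneg_of_nonpos_of_nonpos h₂.le h₃.le))
        (by positivity)
    · exact not_lt.2 ((isConflictSeq_parabola hx hpos).orient_neg m (m + 1) (m + 2) (by omega)
        (by omega)).le

/-! ## Amortized greedy partitioning -/

theorem isAmortizedDLinear_append_singleton {k : ℕ} {l : List Point} {p : Point}
    (hl : IsAmortizedDLinear k l) (hp : ops (l ++ [p]) ≤ k * (l.length + 1)) :
    IsAmortizedDLinear k (l ++ [p]) := by
  intro i hi
  rw [List.length_append, List.length_singleton] at hi
  rcases Nat.lt_succ_iff_lt_or_eq.1 (Nat.lt_succ_of_le hi) with h | rfl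
  · rw [List.take_append_of_le_length (by omega)]
    exact hl i (by omega)
  · rwa [List.take_of_length_le (by simp)]

theorem IsAmortizedDLinear.ops_le {k : ℕ} {l : List Point} (hl : IsAmortizedDLinear k l) :
    ops l ≤ k * l.length := by
  simpa using hl l.length le_rfl

theorem IsAmortizedDLinear.of_append {k : ℕ} {l t : List Point}
    (h : IsAmortizedDLinear k (l ++ t)) : IsAmortizedDLinear k l := by
  intro i hi
  have := h i (by rw [List.length_append]; omega)
  rwa [List.take_append_of_le_length hi] at this

theorem isAmortizedDLinear_singleton (k : ℕ) (p : Point) : IsAmortizedDLinear k [p] := by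
  intro i hi
  match i with
  | 0 => exact Nat.zero_le _
  | i + 1 =>
    rw [List.take_of_length_le (by simp)]
    exact Nat.zero_le _

/-- The first point is free, so the credit after it is `k`. -/
theorem amortizedGreedy_cons (k : ℕ) (p : Point) (l : List Point) :
    amortizedGreedy k (p :: l) = greedyFrom k (stateFrom .empty [p]) k [p] l := rfl

theorem length_greedyFrom_le (k : ℕ) (l : List Point) :
    ∀ (s : State) (c : ℕ) (cur : List Point), (greedyFrom k s c cur l).length ≤ l.length + 1 := by
  induction l with
  | nil => simp [greedyFrom]
  | cons p l ih =>
    intro s c cur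
    rw [greedyFrom]
    split_ifs
    · exact (ih _ _ _).trans (by simp)
    · simpa using ih _ _ _

theorem length_amortizedGreedy_le (k : ℕ) (l : List Point) :
    (amortizedGreedy k l).length ≤ l.length := by
  cases l with
  | nil => simp [amortizedGreedy]
  | cons p l => exact length_greedyFrom_le _ _ _ _ _

/-- Greedy partitioning extends the current run as long as it stays amortized linear. -/
theorem greedyFrom_append {k : ℕ} (l₂ l₁ : List Point) :
    ∀ (cur : List Point) (c : ℕ), c + ops cur = k * cur.length →
      IsAmortizedDLinear k (cur ++ l₁) →
      ∃ c', c' + ops (cur ++ l₁) = k * (cur ++ l₁).length ∧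
        greedyFrom k (stateFrom .empty cur) c cur (l₁ ++ l₂) =
          greedyFrom k (stateFrom .empty (cur ++ l₁)) c' (cur ++ l₁) l₂ := by
  induction l₁ with
  | nil => exact fun cur c hc _ => ⟨c, by simpa using hc, by simp⟩
  | cons p l₁ ih =>
    intro cur c hc hl
    rw [List.append_cons] at hl
    have hp := hl.of_append.ops_le
    rw [ops_append_singleton, List.length_append, List.length_singleton, mul_add, mul_one] at hp
    -- By the invariant the credit is `k * cur.length - ops cur`, so greedy's test is the linearity
    -- condition for `cur ++ [p]`.
    have hle : (insertPoint (stateFrom .empty cur) p).2 ≤ k + c := by omega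
    obtain ⟨c', hc', h⟩ := ih (cur ++ [p]) (k + c - (insertPoint (stateFrom .empty cur) p).2)
      (by
        rw [ops_append_singleton, List.length_append, List.length_singleton, mul_add, mul_one]
        omega) hl
    rw [← List.append_cons] at hc' h
    refine ⟨c', hc', ?_⟩
    rw [← h, List.cons_append, greedyFrom, if_pos hle, stateFrom_append_singleton]

/-- If all runs that can arise are short, greedy partitioning yields many runs. -/
theorem length_le_mul_length_greedyFrom {k L : ℕ} (l : List Point) :
    ∀ (cur : List Point) (c : ℕ), c + ops cur = k * cur.length → IsAmortizedDLinear k cur →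
      (∀ t, t <+: l → IsAmortizedDLinear k (cur ++ t) → (cur ++ t).length ≤ L) →
      (∀ R, R <:+: l → IsAmortizedDLinear k R → R.length ≤ L) →
      cur.length + l.length ≤ L * (greedyFrom k (stateFrom .empty cur) c cur l).length := by
  induction l with
  | nil =>
    intro cur c hc hcur hpre _
    simpa [greedyFrom] using hpre [] List.nil_prefix (by simpa using hcur)
  | cons p l ih =>
    intro cur c hc hcur hpre hinf
    have hinf' : ∀ R, R <:+: l → IsAmortizedDLinear k R → R.length ≤ L := fun R hR =>
      hinf R (hR.trans (List.suffix_cons p l).isInfix)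
    rw [greedyFrom]
    split_ifs with hle
    · have hops : ops (cur ++ [p]) ≤ k * (cur.length + 1) := by
        rw [ops_append_singleton, mul_add, mul_one]
        omega
      have h := ih (cur ++ [p]) (k + c - (insertPoint (stateFrom .empty cur) p).2)
        (by
          rw [ops_append_singleton, List.length_append, List.length_singleton, mul_add, mul_one]
          omega)
        (isAmortizedDLinear_append_singleton hcur hops)
        (fun t ht => by
          rw [← List.append_cons]
          exact hpre (p :: t) (List.cons_prefix_cons.2 ⟨rfl, ht⟩))
        hinf'
      rw [stateFrom_append_singleton, List.length_append, List.length_singleton] at h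
      rw [List.length_cons]
      omega
    -- After a restart the current run is itself a block of the remaining list, so the bound on
    -- blocks takes over the role of `hpre`.
    · have h := ih [p] k (mul_one k).symm (isAmortizedDLinear_singleton k p)
        (fun t ht => hinf (p :: t) (List.cons_prefix_cons.2 ⟨rfl, ht⟩).isInfix) hinf'
      have h' : cur.length ≤ L := by
        simpa using hpre [] List.nil_prefix (by simpa using hcur)
      change cur.length + (p :: l).length ≤
        L * ((greedyFrom k (stateFrom .empty [p]) k [p] l).length + 1)
      rw [List.length_singleton] at h
      rw [List.length_cons, mul_add, mul_one]
      omega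

theorem eq_initial_of_infix {q : ℕ → Point} {n : ℕ} {R : List Point} (h : R <:+: initial q n) :
    ∃ j, R = initial (fun i => q (j + i)) R.length := by
  obtain ⟨s, t, h⟩ := h
  have hlen := congrArg List.length h
  simp only [List.length_append, length_initial] at hlen
  refine ⟨s.length, ?_⟩
  rw [← hlen, add_assoc, initial_add, initial_add, List.append_assoc] at h
  exact (List.append_inj (List.append_inj h (by simp)).2 (by simp)).1

/-! ## Threshold lengths -/

/-- A conflict sequence of at most `2 * k + 4` points is amortized linear. -/
theorem IsConflictSeq.isAmortizedDLinear {q : ℕ → Point} (hq : IsConflictSeq q) {k n : ℕ}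
    (hk : 0 < k) (hn : n ≤ 2 * k + 4) : IsAmortizedDLinear k (initial q n) := by
  intro i hi
  rw [length_initial] at hi
  rw [take_initial q hi]
  match i with
  | 0 => exact Nat.zero_le _
  | 1 => exact Nat.zero_le _
  | m + 2 =>
    have h := hq.two_mul_ops m
    have hm : m ≤ 2 * k + 2 := by omega
    -- From `m ≤ 2 * k + 2`: m² - m ≤ 2km + m, and m ≤ 4k because k ≥ 1.
    nlinarith [Nat.mul_le_mul_left m hm]

/-- A conflict sequence of more than `2 * k + 4` points is not amortized linear. -/
theorem IsConflictSeq.length_le {q : ℕ → Point} (hq : IsConflictSeq q) {k : ℕ} {R : List Point}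
    (hR : R.take (2 * k + 5) = initial q (2 * k + 5)) (hlin : IsAmortizedDLinear k R) :
    R.length ≤ 2 * k + 4 := by
  by_contra! hlt
  have h := hlin (2 * k + 5) hlt
  rw [hR] at h
  -- Twice the cost is (2k + 3)(2k + 2), which exceeds 2k(2k + 5) by 6.
  have h' := hq.two_mul_ops (2 * k + 3)
  nlinarith

/-! ## The family of sequences -/

/-- Abscissas on the second parabola: `2 * k + 4` values in `(-1/4, 0]`, the last of which is `0`,
followed by values from `2` on. -/
noncomputable def capParam (k i : ℕ) : ℝ :=
  if i < 2 * k + 4 then ((i : ℝ) - (2 * k + 3)) / (4 * (2 * k + 4))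
  else 5 / 2 - 1 / (2 * ((i : ℝ) - (2 * k + 3)))

/-- From index `2 * k + 4` on, only the value 2 at that index occurs in `hardSeq`. The later values,
increasing towards 5/2, merely extend the list to an infinite conflict sequence. -/
theorem capParam_strictMono (k : ℕ) : StrictMono (capParam k) := by
  refine strictMono_nat_of_lt_succ fun i => ?_
  have hk : (0 : ℝ) ≤ k := k.cast_nonneg
  rcases lt_trichotomy (i + 1) (2 * k + 4) with h | h | h
  · rw [capParam, capParam, if_pos (by omega), if_pos h]
    push_cast
    gcongr
    linarith
  · rw [capParam, capParam, if_pos (by omega), if_neg (by omega), h]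
    obtain rfl : i = 2 * k + 3 := by omega
    push_cast
    norm_num
  · rw [capParam, capParam, if_neg (by omega), if_neg (by omega)]
    have hi : (2 * k + 4 : ℝ) ≤ i := by exact_mod_cast Nat.lt_succ_iff.1 h
    push_cast
    have : 1 / (2 * ((i : ℝ) + 1 - (2 * k + 3))) < 1 / (2 * ((i : ℝ) - (2 * k + 3))) :=
      one_div_lt_one_div_of_lt (by linarith) (by linarith)
    linarith

theorem capParam_lt (k i : ℕ) : capParam k i < 5 / 2 := by
  have hk : (0 : ℝ) ≤ k := k.cast_nonneg
  rw [capParam]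
  split_ifs with h
  · have hi : (i : ℝ) < 2 * k + 4 := by exact_mod_cast h
    rw [div_lt_iff₀ (by linarith)]
    linarith
  · have hi : (2 * k + 4 : ℝ) ≤ i := by exact_mod_cast not_lt.1 h
    have : 0 < 1 / (2 * ((i : ℝ) - (2 * k + 3))) := one_div_pos.2 (by linarith)
    linarith

/-- The lower bound keeps these points of the second parabola above the horizontal axis, as general
position requires below. -/
theorem capParam_bounds {k i : ℕ} (h : i < 2 * k + 4) :
    -(1 / 4) < capParam k i ∧ capParam k i ≤ 0 := by
  have hk : (0 : ℝ) ≤ k := k.cast_nonneg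
  have hi0 : (0 : ℝ) ≤ i := i.cast_nonneg
  have hi : (i : ℝ) ≤ 2 * k + 3 := by exact_mod_cast Nat.lt_succ_iff.1 h
  rw [capParam, if_pos h]
  constructor
  · rw [lt_div_iff₀ (by linarith)]
    linarith
  · rw [div_le_iff₀ (by linarith)]
    linarith

theorem cap_capParam_apex (k : ℕ) : cap (capParam k (2 * k + 3)) = (0, 1) := by
  simp [capParam, cap]

/-- Abscissas on the first parabola. -/
noncomputable def parabolaParam (i : ℕ) : ℝ := 2 / ((i : ℝ) + 1)

theorem parabolaParam_pos (i : ℕ) : 0 < parabolaParam i := by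
  rw [parabolaParam]
  positivity

theorem parabolaParam_le (i : ℕ) : parabolaParam i ≤ 2 := by
  rw [parabolaParam, div_le_iff₀ (by positivity)]
  linarith [(i.cast_nonneg : (0 : ℝ) ≤ i)]

theorem parabolaParam_strictAnti : StrictAnti parabolaParam := by
  intro i j hij
  have : (i : ℝ) < j := by exact_mod_cast hij
  rw [parabolaParam, parabolaParam]
  gcongr

/-- The infinite sequence of which the sequences of the family are initial segments: `2 * k + 4`
points on the second parabola, up to `(0, 1)`, and then points on the first one. -/
noncomputable def hardSeq (k i : ℕ) : Point :=
  if i < 2 * k + 4 then cap (capParam k i) else parabola (parabolaParam (i - (2 * k + 4)))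

theorem hardSeq_of_lt {k i : ℕ} (h : i < 2 * k + 4) : hardSeq k i = cap (capParam k i) := if_pos h

theorem hardSeq_add (k i : ℕ) : hardSeq k (2 * k + 4 + i) = parabola (parabolaParam i) := by
  simp [hardSeq]

/-- Index `2 * k + 4` is included because (2, 4) lies on both parabolas; this extra point overruns
greedy's first run. -/
theorem hardSeq_of_le {k i : ℕ} (h : i ≤ 2 * k + 4) : hardSeq k i = cap (capParam k i) := by
  rcases h.lt_or_eq with h | rfl
  · exact hardSeq_of_lt h
  · norm_num [hardSeq, capParam, cap, parabola, parabolaParam]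

theorem initial_hardSeq_of_le {k n : ℕ} (h : n ≤ 2 * k + 5) :
    initial (hardSeq k) n = initial (fun i => cap (capParam k i)) n :=
  List.map_congr_left fun _ hi => hardSeq_of_le (by have := List.mem_range.1 hi; omega)

theorem isConflictSeq_capParam (k : ℕ) : IsConflictSeq fun i => cap (capParam k i) :=
  isConflictSeq_cap (capParam_strictMono k) (capParam_lt k)

theorem isConflictSeq_parabolaParam : IsConflictSeq fun i => parabola (parabolaParam i) :=
  isConflictSeq_parabola parabolaParam_strictAnti parabolaParam_pos

theorem initial_hardSeq_add (k n : ℕ) :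
    initial (hardSeq k) (2 * k + 4 + n) =
      initial (hardSeq k) (2 * k + 4) ++ initial (fun i => parabola (parabolaParam i)) n := by
  simp only [initial_add, hardSeq_add]

/-- The good cut, one point before greedy's, so that (0, 1) opens the second run. -/
theorem initial_hardSeq_split (k n : ℕ) :
    initial (hardSeq k) (2 * k + 4 + n) =
      initial (hardSeq k) (2 * k + 3) ++
        ((0, 1) :: initial (fun i => parabola (parabolaParam i)) n) := by
  rw [initial_hardSeq_add, initial_succ, List.append_assoc, List.singleton_append,
    hardSeq_of_lt (by omega), cap_capParam_apex]

/-! ### General position -/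

theorem orient_eq_zero_of_collinear {a b c : Point} (h : Collinear ℝ ({a, b, c} : Set Point)) :
    orient a b c = 0 := by
  obtain ⟨v, hv⟩ := (collinear_iff_of_mem (p₀ := a) (by simp)).1 h
  obtain ⟨r, hr⟩ := hv b (by simp)
  obtain ⟨t, ht⟩ := hv c (by simp)
  rw [hr, ht]
  simp only [orient, vadd_eq_add, Prod.fst_add, Prod.snd_add, Prod.smul_fst, Prod.smul_snd,
    smul_eq_mul]
  ring

theorem orient_rotate (a b c : Point) : orient b c a = orient a b c := by
  simp only [orient]
  ring

theorem orient_cap_cap_parabola_ne_zero {a b t : ℝ} (hab : a < b) (hb : b ≤ 0) (ht : 0 < t)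
    (ht' : t ≤ 2) : orient (cap a) (cap b) (parabola t) ≠ 0 := by
  have h : orient (cap a) (cap b) (parabola t) =
      -((b - a) * (1 + t * (5 / 2 - t) + -(a + b) * t / 2 + -a * -b / 2)) := by
    simp only [orient, cap, parabola]
    ring
  rw [h, neg_ne_zero]
  have h₁ : 0 < b - a := by linarith
  have h₂ : 0 < 5 / 2 - t := by linarith
  have h₃ : 0 ≤ -(a + b) := by linarith
  have h₄ : 0 ≤ -a := by linarith
  have h₅ : 0 ≤ -b := by linarith
  positivity

theorem orient_cap_parabola_parabola_ne_zero {a s t : ℝ} (ha : -(1 / 4) < a) (ha' : a ≤ 0)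
    (hs : 0 < s) (ht : 0 < t) (hst : t < s) :
    orient (cap a) (parabola s) (parabola t) ≠ 0 := by
  have h : orient (cap a) (parabola s) (parabola t) =
      -((s - t) * ((1 + 5 / 2 * a - a ^ 2 / 2) + (s + t) * -a + s * t)) := by
    simp only [orient, cap, parabola]
    ring
  rw [h, neg_ne_zero]
  have h₁ : 0 < s - t := by linarith
  have h₂ : 0 < 1 + 5 / 2 * a - a ^ 2 / 2 := by nlinarith
  have h₃ : 0 ≤ -a := by linarith
  positivity

/-- The cases are the numbers of points on each parabola; the mixed ones have a factorization with a
cofactor of constant sign. -/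
theorem orient_hardSeq_ne_zero (k : ℕ) {i j l : ℕ} (hij : i < j) (hjl : j < l) :
    orient (hardSeq k i) (hardSeq k j) (hardSeq k l) ≠ 0 := by
  rcases lt_or_ge l (2 * k + 4) with hl | hl
  · rw [hardSeq_of_lt hl, hardSeq_of_lt (by omega), hardSeq_of_lt (by omega)]
    exact ((isConflictSeq_capParam k).orient_neg i j l hij hjl).ne
  obtain ⟨l, rfl⟩ := Nat.exists_eq_add_of_le hl
  rcases lt_or_ge j (2 * k + 4) with hj | hj
  · rw [hardSeq_add, hardSeq_of_lt hj, hardSeq_of_lt (by omega)]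
    exact orient_cap_cap_parabola_ne_zero (capParam_strictMono k hij) (capParam_bounds hj).2
      (parabolaParam_pos _) (parabolaParam_le _)
  obtain ⟨j, rfl⟩ := Nat.exists_eq_add_of_le hj
  rw [hardSeq_add, hardSeq_add]
  rcases lt_or_ge i (2 * k + 4) with hi | hi
  · rw [hardSeq_of_lt hi]
    exact orient_cap_parabola_parabola_ne_zero (capParam_bounds hi).1 (capParam_bounds hi).2
      (parabolaParam_pos _) (parabolaParam_pos _) (parabolaParam_strictAnti (by omega))
  obtain ⟨i, rfl⟩ := Nat.exists_eq_add_of_le hi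
  rw [hardSeq_add]
  exact (isConflictSeq_parabolaParam.orient_neg i j l (by omega) (by omega)).ne

theorem hardSeq_injective (k : ℕ) : Function.Injective (hardSeq k) := by
  refine Function.Injective.of_lt_imp_ne fun i j hij h => ?_
  -- Equal points would have orientation zero with any third point; the next one serves.
  have := orient_hardSeq_ne_zero k hij j.lt_succ_self
  rw [h] at this
  simp [orient] at this

theorem inGeneralPosition_initial_hardSeq (k n : ℕ) :
    InGeneralPosition (initial (hardSeq k) n) := by
  refine ⟨List.nodup_range.map (hardSeq_injective k), ?_⟩
  intro a ha b hb c hc hab hac hbc hcol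
  simp only [initial, List.mem_map] at ha hb hc
  obtain ⟨i, -, rfl⟩ := ha
  obtain ⟨j, -, rfl⟩ := hb
  obtain ⟨l, -, rfl⟩ := hc
  have h := orient_eq_zero_of_collinear hcol
  have hij : i ≠ j := fun h => hab (congrArg _ h)
  have hil : i ≠ l := fun h => hac (congrArg _ h)
  have hjl : j ≠ l := fun h => hbc (congrArg _ h)
  have h' : orient (hardSeq k j) (hardSeq k i) (hardSeq k l) = 0 := by
    rw [orient_swap, h, neg_zero]
  rcases hij.lt_or_gt with h₁ | h₁ <;> rcases hil.lt_or_gt with h₂ | h₂ <;>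
    rcases hjl.lt_or_gt with h₃ | h₃
  · exact orient_hardSeq_ne_zero k h₁ h₃ h
  · exact orient_hardSeq_ne_zero k h₂ h₃ (by rw [orient_rotate, h'])
  · omega
  · exact orient_hardSeq_ne_zero k h₂ h₁ (by rw [← orient_rotate, h])
  · exact orient_hardSeq_ne_zero k h₁ h₂ h'
  · omega
  · exact orient_hardSeq_ne_zero k h₃ h₂ (by rw [orient_rotate, h])
  · exact orient_hardSeq_ne_zero k h₃ h₁ (by rw [← orient_rotate, h'])

/-! ### Greedy and optimal partitions -/

theorem take_initial_hardSeq {k n : ℕ} (h : 2 * k + 5 ≤ n) :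
    (initial (hardSeq k) n).take (2 * k + 5) =
      initial (fun i => cap (capParam k i)) (2 * k + 5) := by
  rw [take_initial _ h, initial_hardSeq_of_le le_rfl]

theorem isAmortizedDLinear_initial_hardSeq {k n : ℕ} (hk : 0 < k) (hn : n ≤ 2 * k + 4) :
    IsAmortizedDLinear k (initial (hardSeq k) n) := by
  rw [initial_hardSeq_of_le (by omega)]
  exact (isConflictSeq_capParam k).isAmortizedDLinear hk hn

theorem length_le_of_isAmortizedDLinear_of_infix {k n : ℕ} {R : List Point}
    (hR : R <:+: initial (fun i => parabola (parabolaParam i)) n)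
    (hlin : IsAmortizedDLinear k R) : R.length ≤ 2 * k + 4 := by
  by_contra! hlt
  obtain ⟨j, hj⟩ := eq_initial_of_infix hR
  refine hlt.not_ge ((isConflictSeq_parabolaParam.comp_add j).length_le ?_ hlin)
  rw [hj, take_initial _ hlt]

theorem length_le_mul_length_amortizedGreedy {k : ℕ} (hk : 0 < k) (n : ℕ) :
    2 * k + 4 + n ≤
      (2 * k + 4) * (amortizedGreedy k (initial (hardSeq k) (2 * k + 4 + n))).length := by
  have hcons : initial (hardSeq k) (2 * k + 4) =
      [hardSeq k 0] ++ initial (fun i => hardSeq k (1 + i)) (2 * k + 3) := by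
    rw [show 2 * k + 4 = 1 + (2 * k + 3) by omega, initial_add]
    rfl
  have hlin := isAmortizedDLinear_initial_hardSeq hk (le_refl (2 * k + 4))
  -- Greedy is forced to take all `2 * k + 4` points of the second parabola, including (0, 1).
  obtain ⟨c, hc, h⟩ := greedyFrom_append (initial (fun i => parabola (parabolaParam i)) n)
    (initial (fun i => hardSeq k (1 + i)) (2 * k + 3)) [hardSeq k 0] k (mul_one k).symm (hcons ▸ hlin)
  rw [← hcons] at hc h
  rw [initial_hardSeq_add, hcons, List.append_assoc, List.singleton_append, amortizedGreedy_cons, h]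
  have := length_le_mul_length_greedyFrom (L := 2 * k + 4)
    (initial (fun i => parabola (parabolaParam i)) n) _ c hc hlin ?_
    fun R hR => length_le_of_isAmortizedDLinear_of_infix hR
  · simpa using this
  -- A longer first run would contain the first `2 * k + 5` points, all on the second parabola.
  · rintro t ⟨t', ht⟩ htlin
    by_contra! hlt
    refine hlt.not_ge ((isConflictSeq_capParam k).length_le ?_ htlin)
    rw [← take_initial_hardSeq (n := 2 * k + 4 + n), initial_hardSeq_add, ← ht,
      ← List.append_assoc, List.take_append_of_le_length hlt]
    have := congrArg List.length ht
    simp only [List.length_append, length_initial] at this hlt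
    omega

theorem isRunPartition_initial_hardSeq {k : ℕ} (hk : 0 < k) (n : ℕ) :
    IsRunPartition k (initial (hardSeq k) (2 * k + 4 + n))
      [initial (hardSeq k) (2 * k + 3),
        (0, 1) :: initial (fun i => parabola (parabolaParam i)) n] := by
  refine ⟨by simp [initial_hardSeq_split], ?_⟩
  simp only [List.mem_cons, List.not_mem_nil, or_false, forall_eq_or_imp, forall_eq]
  refine ⟨⟨List.ne_nil_of_length_pos (by simp),
    isAmortizedDLinear_initial_hardSeq hk (by omega)⟩, by simp, ?_⟩
  intro i hi
  match i with
  | 0 => exact Nat.zero_le _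
  | i + 1 =>
    rw [List.take_succ_cons, take_initial _ (by simpa using hi),
      ops_apex_parabola parabolaParam_strictAnti parabolaParam_pos]
    exact Nat.zero_le _

/-- A single run would begin with the `2 * k + 5` conflicting points, which are too expensive. -/
theorem two_le_length_of_isRunPartition {k n : ℕ} (hn : 2 * k + 5 ≤ n) {P : List (List Point)}
    (hP : IsRunPartition k (initial (hardSeq k) n) P) : 2 ≤ P.length := by
  obtain ⟨hflat, hruns⟩ := hP
  match P with
  | [] =>
    have := congrArg List.length hflat
    simp at this
    omega
  | [R] =>
    obtain rfl : R = initial (hardSeq k) n := by simpa using hflat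
    have := (isConflictSeq_capParam k).length_le (take_initial_hardSeq hn) (hruns _ (by simp)).2
    rw [length_initial] at this
    omega
  | _ :: _ :: _ => simp

end DelaunayRuns

/-! ### The main theorem -/

theorem mainTheorem8 (k : ℕ) (hk : 0 < k) :
    ∃ S : ℕ → List DelaunayRuns.Point,
      (∀ n : ℕ, (S n).length = n ∧ DelaunayRuns.InGeneralPosition (S n)) ∧
      (fun n : ℕ => ((DelaunayRuns.amortizedGreedy k (S n)).length : ℝ)) =Θ[atTop]
        (fun n : ℕ => (n : ℝ)) ∧
      ∀ᶠ n : ℕ in atTop,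
        IsLeast {m : ℕ | ∃ P : List (List DelaunayRuns.Point),
          DelaunayRuns.IsRunPartition k (S n) P ∧ P.length = m} 2 := by
  refine ⟨DelaunayRuns.initial (DelaunayRuns.hardSeq k), fun n =>
    ⟨DelaunayRuns.length_initial _ n, DelaunayRuns.inGeneralPosition_initial_hardSeq k n⟩,
    ⟨?_, ?_⟩, ?_⟩
  · refine IsBigO.of_bound 1 (Eventually.of_forall fun n => ?_)
    rw [one_mul, Real.norm_natCast, Real.norm_natCast, Nat.cast_le]
    simpa using DelaunayRuns.length_amortizedGreedy_le k
      (DelaunayRuns.initial (DelaunayRuns.hardSeq k) n)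
  · refine IsBigO.of_bound (2 * k + 4 : ℕ) ?_
    filter_upwards [eventually_ge_atTop (2 * k + 4)] with n hn
    obtain ⟨n, rfl⟩ := Nat.exists_eq_add_of_le hn
    rw [Real.norm_natCast, Real.norm_natCast, ← Nat.cast_mul, Nat.cast_le]
    exact DelaunayRuns.length_le_mul_length_amortizedGreedy hk n
  · filter_upwards [eventually_ge_atTop (2 * k + 5)] with n hn
    refine ⟨?_, ?_⟩
    · obtain ⟨n, rfl⟩ := Nat.exists_eq_add_of_le (show 2 * k + 4 ≤ n by omega)
      exact ⟨_, DelaunayRuns.isRunPartition_initial_hardSeq hk n, rfl⟩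
    · rintro _ ⟨P, hP, rfl⟩
      exact DelaunayRuns.two_le_length_of_isRunPartition hn hP
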